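/- For a positive integer $n$, let $E_n=\{x_i=1,\ x_i+x_j=x_k,\ x_i\cdot x_j=x_k : i,j,k\in\{1,\ldots,n\}\}$, and let $f(n)$ denote the greatest finite total number of solutions of a subsystem of $E_n$ in integers $x_1,\ldots,x_n$. A set $M\subseteq\mathbb{N}^n$ (with $0\in\mathbb{N}$) has a finite-fold Diophantine representation if there are $m$ and a polynomial $W$ with integer coefficients such that, for all $a\in\mathbb{N}^n$, $a\in M$ if and only if $W(a,x)=0$ for some $x\in\mathbb{N}^m$, and such that for each $a\in\mathbb{N}^n$ the equation $W(a,x)=0$ has only finitely many solutions $x\in\mathbb{N}^m$. A finite-fold Diophantine representation of a function $g$ from positive integers to positive integers is one of its graph $\{(k,g(k)) : k\geq 1\}\subseteq\mathbb{N}^2$. Theorem. Suppose that there is an algorithm which takes as input an arbitrary Diophantine equation $D(x_1,\ldots,x_p)=0$, where $D\in\mathbb{Z}[x_1,\ldots,x_p]$, and always returns an integer, such that this integer is greater than the number of integer solutions of the equation whenever the solution set is finite. Then there is a computable, strictly increasing function $g$ from positive integers to positive integers such that $f(n)\leq g(n)$ for every positive integer $n$, and $g$ has no finite-fold Diophantine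 representation. Consequently, under the same supposition, Matiyasevich's conjecture, that for every $n$ each recursively enumerable set $M\subseteq\mathbb{N}^n$ has a finite-fold Diophantine representation, is false. -/

import Mathlib

namespace FiniteFold

/-- An equation from `E_n`: one of `x_i = 1`, `x_i + x_j = x_k`, `x_i * x_j = x_k`,
with indices `i, j, k` that need not be distinct. -/
inductive ElemEq (n : ℕ) : Type
  | one (i : Fin n) : ElemEq n
  | add (i j k : Fin n) : ElemEq n
  | mul (i j k : Fin n) : ElemEq n

/-- The integer tuple `x` satisfies the given equation of `E_n`. -/
def ElemEq.Holds {n : ℕ} (x : Fin n → ℤ) : ElemEq n → Prop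
  | .one i => x i = 1
  | .add i j k => x i + x j = x k
  | .mul i j k => x i * x j = x k

/-- The set of integer solutions of a subsystem `S` of `E_n`. -/
def systemSolutions {n : ℕ} (S : Set (ElemEq n)) : Set (Fin n → ℤ) :=
  {x | ∀ e ∈ S, e.Holds x}

/-- The numbers of solutions of those subsystems of `E_n` that have only finitely many
integer solutions. -/
def finiteCounts (n : ℕ) : Set ℕ :=
  {m | ∃ S : Set (ElemEq n), (systemSolutions S).Finite ∧ (systemSolutions S).ncard = m}

/-- `f n` is the greatest finite total number of integer solutions of a subsystem of `E_n`;
see `f_isGreatest`. -/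
noncomputable def f (n : ℕ+) : ℕ := sSup (finiteCounts n)

theorem finite_elemEq (n : ℕ) : Finite (ElemEq n) := by
  let φ : ElemEq n → Fin n ⊕ (Fin n × Fin n × Fin n) ⊕ (Fin n × Fin n × Fin n) := fun e =>
    match e with
    | .one i => .inl i
    | .add i j k => .inr (.inl (i, j, k))
    | .mul i j k => .inr (.inr (i, j, k))
  refine Finite.of_injective φ ?_
  rintro (_ | _ | _) (_ | _ | _) h <;> simp_all [φ]

/-- The supremum that defines `f` is an attained maximum. -/
theorem f_isGreatest (n : ℕ+) : IsGreatest (finiteCounts n) (f n) := by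
  have := finite_elemEq n
  have hfin : (finiteCounts n).Finite :=
    (Set.finite_range fun S : Set (ElemEq n) => (systemSolutions S).ncard).subset
      fun m ⟨S, _, h⟩ => ⟨S, h⟩
  have hne : (finiteCounts n).Nonempty := by
    refine ⟨_, Set.univ, (Set.finite_singleton (fun _ => (1 : ℤ))).subset ?_, rfl⟩
    intro x hx
    exact funext fun i => hx (.one i) trivial
  exact ⟨Nat.sSup_mem hne hfin.bddAbove, fun m hm => le_csSup hfin.bddAbove hm⟩

/-- A Diophantine equation as the input of an algorithm: the number `p` of its variables and the
list of its terms.  The term `(c, [e₀, e₁, …])` stands for `c * x₀ ^ e₀ * x₁ ^ e₁ * ⋯`, where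
exponents missing from the list are `0` and exponents beyond the `p`-th are ignored.
The type has a canonical Gödel numbering, given by the instances for `×`, `List`, `ℤ` and `ℕ`. -/
abbrev DiophEq : Type := ℕ × List (ℤ × List ℕ)

/-- The polynomial `D` of the equation `D = 0`. -/
noncomputable def DiophEq.poly (E : DiophEq) : MvPolynomial (Fin E.1) ℤ :=
  (E.2.map fun t =>
    MvPolynomial.C t.1 * ∏ i : Fin E.1, MvPolynomial.X i ^ t.2.getD i 0).sum

/-- Every integer polynomial in finitely many variables is given by some code. -/
theorem DiophEq.exists_poly_eq (p : ℕ) (D : MvPolynomial (Fin p) ℤ) :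
    ∃ L : List (ℤ × List ℕ), DiophEq.poly (p, L) = D := by
  refine ⟨D.support.toList.map fun s => (D.coeff s, List.ofFn s), ?_⟩
  conv_rhs => rw [D.as_sum]
  simp only [DiophEq.poly, List.map_map, ← Finset.sum_map_toList]
  congr 1
  refine List.map_congr_left fun s _ => ?_
  rw [MvPolynomial.monomial_eq, Finsupp.prod_fintype _ _ (by simp)]
  simp

/-- The set of integer solutions of a Diophantine equation. -/
def DiophEq.solutions (E : DiophEq) : Set (Fin E.1 → ℤ) :=
  {x | MvPolynomial.eval x E.poly = 0}

/-- There is an algorithm that takes as input a Diophantine equation and always returns an integer,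
and this integer is greater than the number of integer solutions if the solution set is finite. -/
def CountBoundComputable : Prop :=
  ∃ A : DiophEq → ℤ, Computable A ∧
    ∀ E : DiophEq, E.solutions.Finite → (E.solutions.ncard : ℤ) < A E

/-- `M ⊆ ℕⁿ` has a finite-fold Diophantine representation: there is an integer polynomial `W` with
`a ∈ M ↔ ∃ x ∈ ℕᵐ, W (a, x) = 0`, and for each `a ∈ ℕⁿ` the equation `W (a, x) = 0` has only
finitely many solutions `x ∈ ℕᵐ`. -/
def HasFiniteFoldRep {n : ℕ} (M : Set (Fin n → ℕ)) : Prop :=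
  ∃ (m : ℕ) (W : MvPolynomial (Fin n ⊕ Fin m) ℤ),
    (∀ a : Fin n → ℕ, a ∈ M ↔
      ∃ x : Fin m → ℕ, MvPolynomial.eval (fun v => ((Sum.elim a x v : ℕ) : ℤ)) W = 0) ∧
    ∀ a : Fin n → ℕ,
      {x : Fin m → ℕ | MvPolynomial.eval (fun v => ((Sum.elim a x v : ℕ) : ℤ)) W = 0}.Finite

/-- The graph of a function from positive integers to positive integers, as a subset of `ℕ²`. -/
def graph (g : ℕ+ → ℕ+) : Set (Fin 2 → ℕ) :=
  {a | ∃ k : ℕ+, a 0 = k ∧ a 1 = g k}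

/-- Matiyasevich's conjecture: every recursively enumerable subset of `ℕⁿ` has a finite-fold
Diophantine representation. -/
def MatiyasevichConjecture : Prop :=
  ∀ (n : ℕ) (M : Set (Fin n → ℕ)), REPred (fun a => a ∈ M) → HasFiniteFoldRep M

end FiniteFold

/-! The argument is a diagonalization. With the assumed algorithm, a computable `H n` bounds the
number of solutions of every finitely solvable equation in the list `candidates n`. That list
contains each subsystem of `E_n`, merged into one equation by a sum of squares, and each equation
with code at most `n` after its first variable is forced to equal `n`. Partial sums of `H` give a
strictly increasing computable `g` that dominates both `H` and `f`.

If `g` had a finite-fold representation `W(k, y, x) = 0`, replacing `y` by a sum of two naturals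
would give `g k + 1` solutions for each `k`, still finitely many. Four-square sums turn this into a
single equation `E` over the integers (`exists_lt_ncard_solutions_pinned`). At `k = encode E + 1`
the pinned `E` is a candidate, so it has fewer than `H k ≤ g k` solutions, a contradiction. As the
graph of `g` is recursively enumerable, Matiyasevich's conjecture fails too. -/

namespace FiniteFold

open Encodable

/-! ### Evaluation of term lists. -/

/-- The value at `x` of a list of terms, read as in `DiophEq.poly`. -/
def evalTerms {p : ℕ} (x : Fin p → ℤ) (L : List (ℤ × List ℕ)) : ℤ :=
  (L.map fun t => t.1 * ∏ i : Fin p, x i ^ t.2.getD i 0).sum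

theorem eval_poly {p : ℕ} (L : List (ℤ × List ℕ)) (x : Fin p → ℤ) :
    MvPolynomial.eval x (DiophEq.poly (p, L)) = evalTerms x L := by
  simp only [DiophEq.poly, evalTerms, map_list_sum, List.map_map]
  congr 1
  refine List.map_congr_left fun t _ => ?_
  simp

theorem mem_solutions {p : ℕ} {L : List (ℤ × List ℕ)} {x : Fin p → ℤ} :
    x ∈ DiophEq.solutions (p, L) ↔ evalTerms x L = 0 := by
  rw [← eval_poly]; rfl

@[simp]
theorem evalTerms_nil {p : ℕ} (x : Fin p → ℤ) : evalTerms x [] = 0 := rfl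

@[simp]
theorem evalTerms_cons {p : ℕ} (x : Fin p → ℤ) (t : ℤ × List ℕ) (L : List (ℤ × List ℕ)) :
    evalTerms x (t :: L) = t.1 * ∏ i : Fin p, x i ^ t.2.getD i 0 + evalTerms x L := by
  simp [evalTerms]

@[simp]
theorem evalTerms_append {p : ℕ} (x : Fin p → ℤ) (L L' : List (ℤ × List ℕ)) :
    evalTerms x (L ++ L') = evalTerms x L + evalTerms x L' := by
  simp [evalTerms]

@[simp]
theorem evalTerms_replicate {p : ℕ} (x : Fin p → ℤ) (k : ℕ) (t : ℤ × List ℕ) :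
    evalTerms x (List.replicate k t) = k * (t.1 * ∏ i : Fin p, x i ^ t.2.getD i 0) := by
  simp [evalTerms]

theorem evalTerms_flatten {p : ℕ} (x : Fin p → ℤ) (Ls : List (List (ℤ × List ℕ))) :
    evalTerms x Ls.flatten = (Ls.map (evalTerms x)).sum := by
  induction Ls with
  | nil => rfl
  | cons L Ls ih => simp [ih]

theorem evalTerms_flatten_eq_zero_iff {p : ℕ} {x : Fin p → ℤ} {Ls : List (List (ℤ × List ℕ))}
    (h : ∀ t ∈ Ls, 0 ≤ evalTerms x t) :
    evalTerms x Ls.flatten = 0 ↔ ∀ t ∈ Ls, evalTerms x t = 0 := by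
  rw [evalTerms_flatten]
  induction Ls with
  | nil => simp
  | cons t Ls ih =>
    simp only [List.forall_mem_cons] at h ⊢
    rw [List.map_cons, List.sum_cons, add_eq_zero_iff_of_nonneg h.1
      (List.sum_nonneg (by simpa using h.2)), ih h.2]

/-! ### Subsystems of `E_n` as single equations. -/

/-- The exponents, in `n` variables, of the product of the variables with indices in `l`. -/
def exponents (n : ℕ) (l : List ℕ) : List ℕ :=
  (List.range n).map fun v => (l.filter (· = v)).length

theorem getD_exponents {n : ℕ} (l : List (Fin n)) (i : Fin n) :
    (exponents n (l.map Fin.val)).getD i 0 = l.count i := by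
  have hi := i.isLt
  simp only [exponents, List.getD_eq_getElem?_getD, List.getElem?_map, List.getElem?_range hi,
    Option.map_some, Option.getD_some]
  rw [← List.countP_eq_length_filter, List.countP_map, List.count]
  refine List.countP_congr fun a _ => ?_
  simp [Fin.ext_iff]

theorem prod_pow_exponents {n : ℕ} (x : Fin n → ℤ) (l : List (Fin n)) :
    ∏ i : Fin n, x i ^ (exponents n (l.map Fin.val)).getD i 0 = (l.map x).prod := by
  simp only [getD_exponents]
  induction l with
  | nil => simp
  | cons a l ih =>
    simp only [List.count_cons, pow_add, Finset.prod_mul_distrib, List.map_cons, List.prod_cons]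
    rw [ih, mul_comm, Finset.prod_eq_single a]
    · simp
    · intro b _ hb
      simp [Ne.symm hb]
    · simp

/-- The terms of `(x_i - 1)²`. -/
def oneSq (n i : ℕ) : List (ℤ × List ℕ) :=
  [(1, exponents n [i, i]), (-2, exponents n [i]), (1, exponents n [])]

/-- The terms of `(x_i + x_j - x_k)²`. -/
def addSq (n i j k : ℕ) : List (ℤ × List ℕ) :=
  [(1, exponents n [i, i]), (1, exponents n [j, j]), (1, exponents n [k, k]),
    (2, exponents n [i, j]), (-2, exponents n [i, k]), (-2, exponents n [j, k])]

/-- The terms of `(x_i * x_j - x_k)²`. -/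
def mulSq (n i j k : ℕ) : List (ℤ × List ℕ) :=
  [(1, exponents n [i, i, j, j]), (-2, exponents n [i, j, k]), (1, exponents n [k, k])]

/-- The terms of the square of the difference of the two sides of an equation of `E_n`. -/
def ElemEq.sqTerms {n : ℕ} : ElemEq n → List (ℤ × List ℕ)
  | .one i => oneSq n i
  | .add i j k => addSq n i j k
  | .mul i j k => mulSq n i j k

/-- The difference of the two sides of an equation of `E_n`. -/
def ElemEq.defect {n : ℕ} (x : Fin n → ℤ) : ElemEq n → ℤ
  | .one i => x i - 1
  | .add i j k => x i + x j - x k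
  | .mul i j k => x i * x j - x k

theorem ElemEq.defect_eq_zero_iff {n : ℕ} {x : Fin n → ℤ} {e : ElemEq n} :
    e.defect x = 0 ↔ e.Holds x := by
  cases e <;> simp [defect, Holds, sub_eq_zero]

theorem ElemEq.evalTerms_sqTerms {n : ℕ} (x : Fin n → ℤ) (e : ElemEq n) :
    evalTerms x e.sqTerms = e.defect x ^ 2 := by
  have h0 := prod_pow_exponents x []
  have h1 := fun i => prod_pow_exponents x [i]
  have h2 := fun i j => prod_pow_exponents x [i, j]
  have h3 := fun i j k => prod_pow_exponents x [i, j, k]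
  have h4 := fun i j k l => prod_pow_exponents x [i, j, k, l]
  simp only [List.map_cons, List.map_nil] at h0 h1 h2 h3 h4
  cases e <;>
    simp only [sqTerms, oneSq, addSq, mulSq, defect, evalTerms_cons, evalTerms_nil, h0, h1, h2, h3,
      h4, List.prod_cons, List.prod_nil] <;> ring

/-- The squares of all equations of `E_n`. -/
def elemSquares (n : ℕ) : List (List (ℤ × List ℕ)) :=
  (List.range n).map (oneSq n) ++
    (List.range n).flatMap fun i => (List.range n).flatMap fun j => (List.range n).flatMap fun k =>
      [addSq n i j k, mulSq n i j k]

theorem ElemEq.sqTerms_mem {n : ℕ} (e : ElemEq n) : e.sqTerms ∈ elemSquares n := by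
  simp only [elemSquares, List.mem_append, List.mem_map, List.mem_flatMap, List.mem_range]
  cases e with
  | one i => exact .inl ⟨i, i.2, rfl⟩
  | add i j k => exact .inr ⟨i, i.2, j, j.2, k, k.2, by simp [sqTerms]⟩
  | mul i j k => exact .inr ⟨i, i.2, j, j.2, k, k.2, by simp [sqTerms]⟩

/-- For each subsystem of `E_n` a single equation with the same integer solutions. -/
def subsystemEqs (n : ℕ) : List DiophEq :=
  (elemSquares n).sublists'.map fun s => (n, s.flatten)

theorem exists_subsystemEqs {n : ℕ} (S : Set (ElemEq n)) :
    ∃ L, (n, L) ∈ subsystemEqs n ∧ DiophEq.solutions (n, L) = systemSolutions S := by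
  classical
  -- Selection is by term list: `x_i * x_j = x_k` and `x_j * x_i = x_k` share one, which is harmless
  -- because their solutions agree.
  set s := (elemSquares n).filter (· ∈ ElemEq.sqTerms '' S) with hs
  refine ⟨s.flatten, List.mem_map.2 ⟨s, List.mem_sublists'.2 List.filter_sublist, rfl⟩, ?_⟩
  have hmem : ∀ t, t ∈ s ↔ ∃ e ∈ S, e.sqTerms = t := by
    intro t
    simp only [hs, List.mem_filter, decide_eq_true_eq, Set.mem_image, and_iff_right_iff_imp]
    rintro ⟨e, -, rfl⟩
    exact e.sqTerms_mem
  clear_value s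
  ext x
  have hnn : ∀ t ∈ s, 0 ≤ evalTerms x t := by
    intro t ht
    obtain ⟨e, -, rfl⟩ := (hmem t).1 ht
    rw [e.evalTerms_sqTerms]
    positivity
  rw [mem_solutions, evalTerms_flatten_eq_zero_iff hnn]
  constructor
  · intro h e he
    rw [← ElemEq.defect_eq_zero_iff]
    have := h _ ((hmem _).2 ⟨e, he, rfl⟩)
    rwa [e.evalTerms_sqTerms, sq_eq_zero_iff] at this
  · intro h t ht
    obtain ⟨e, he, rfl⟩ := (hmem t).1 ht
    rw [e.evalTerms_sqTerms, ElemEq.defect_eq_zero_iff.2 (h e he)]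
    rfl

/-! ### Prescribing the first variable. -/

/-- The equation `E + (x₀ - k)² = 0`, where `E` is the left side of the given equation. -/
def pinned (E : DiophEq) (k : ℕ) : DiophEq :=
  -- The coefficients `-2k` and `k²` are spelled out as repeated terms, so computability needs no
  -- integer arithmetic.
  (E.1, E.2 ++ ((1, [2]) :: (List.replicate k (-2, [1]) ++ List.replicate (k * k) (1, []))))

theorem mem_solutions_pinned {q : ℕ} {L : List (ℤ × List ℕ)} {k : ℕ} {x : Fin (q + 1) → ℤ} :
    x ∈ DiophEq.solutions (pinned (q + 1, L) k) ↔ evalTerms x L + (x 0 - k) ^ 2 = 0 := by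
  refine mem_solutions.trans ?_
  have : evalTerms x (L ++ ((1, [2]) :: (List.replicate k (-2, [1]) ++
      List.replicate (k * k) (1, [])))) = evalTerms x L + (x 0 - k) ^ 2 := by
    simp only [evalTerms_append, evalTerms_cons, evalTerms_replicate, Fin.prod_univ_succ]
    simp
    ring
  rw [this]

/-! ### Primitive recursiveness of the candidate lists. -/

theorem primrec₂_exponents : Primrec₂ exponents := by
  refine Primrec.list_map (Primrec.list_range.comp .fst) ?_
  have h := PrimrecRel.listFilter (R := fun a b : ℕ => a = b) Primrec.eq
  exact Primrec.list_length.comp (h.comp (Primrec.snd.comp .fst) .snd)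

theorem primrec_sublists' {α : Type*} [Primcodable α] :
    Primrec (List.sublists' : List α → List (List α)) := by
  have h : Primrec fun l : List α =>
      l.foldr (fun a s => s ++ s.map (List.cons a)) [[]] := by
    refine Primrec.list_foldr (h := fun _ (p : α × List (List α)) => p.2 ++ p.2.map (List.cons p.1)) .id
      (.const _) ?_
    refine Primrec.list_append.comp (Primrec.snd.comp .snd)
      (Primrec.list_map (Primrec.snd.comp .snd) ?_)
    exact Primrec.list_cons.comp (Primrec.fst.comp (Primrec.snd.comp .fst)) .snd
  refine h.of_eq fun l => ?_
  induction l with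
  | nil => rfl
  | cons a l ih => rw [List.foldr_cons, ih, List.sublists'_cons]

theorem primrec_replicate {α : Type*} [Primcodable α] (a : α) :
    Primrec fun k => List.replicate k a := by
  refine (Primrec.list_map (g := fun _ _ => a) Primrec.list_range (Primrec.const a).to₂).of_eq ?_
  simp

section Terms

variable {α : Type*} [Primcodable α]

theorem primrec_exponents_pair {u : α → ℕ} {v : α → List ℕ} (hu : Primrec u) (hv : Primrec v)
    (c : ℤ) : Primrec fun a => (c, exponents (u a) (v a)) :=
  (Primrec.const c).pair (primrec₂_exponents.comp hu hv)

theorem primrec_oneSq {u i : α → ℕ} (hu : Primrec u) (hi : Primrec i) :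
    Primrec fun a => oneSq (u a) (i a) := by
  have nil : Primrec fun _ : α => ([] : List ℕ) := .const _
  have cons {w : α → ℕ} {l : α → List ℕ} (hw : Primrec w) (hl : Primrec l) :
    Primrec fun a => w a :: l a := Primrec.list_cons.comp hw hl
  have T {v : α → List ℕ} (c : ℤ) (hv : Primrec v) := primrec_exponents_pair hu hv c
  exact Primrec.list_cons.comp (T _ (cons hi (cons hi nil))) <|
    Primrec.list_cons.comp (T _ (cons hi nil)) <| Primrec.list_cons.comp (T _ nil) (.const [])

theorem primrec_addSq {u i j k : α → ℕ} (hu : Primrec u) (hi : Primrec i) (hj : Primrec j)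
    (hk : Primrec k) : Primrec fun a => addSq (u a) (i a) (j a) (k a) := by
  have T {v w : α → ℕ} (c : ℤ) (hv : Primrec v) (hw : Primrec w) :=
    primrec_exponents_pair hu (Primrec.list_cons.comp hv (Primrec.list_cons.comp hw (.const []))) c
  exact Primrec.list_cons.comp (T _ hi hi) <| Primrec.list_cons.comp (T _ hj hj) <|
    Primrec.list_cons.comp (T _ hk hk) <| Primrec.list_cons.comp (T _ hi hj) <|
    Primrec.list_cons.comp (T _ hi hk) <| Primrec.list_cons.comp (T _ hj hk) (.const [])

theorem primrec_mulSq {u i j k : α → ℕ} (hu : Primrec u) (hi : Primrec i) (hj : Primrec j)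
    (hk : Primrec k) : Primrec fun a => mulSq (u a) (i a) (j a) (k a) := by
  have nil : Primrec fun _ : α => ([] : List ℕ) := .const _
  have cons {w : α → ℕ} {l : α → List ℕ} (hw : Primrec w) (hl : Primrec l) :
    Primrec fun a => w a :: l a := Primrec.list_cons.comp hw hl
  have T {v : α → List ℕ} (c : ℤ) (hv : Primrec v) := primrec_exponents_pair hu hv c
  exact Primrec.list_cons.comp (T _ (cons hi (cons hi (cons hj (cons hj nil))))) <|
    Primrec.list_cons.comp (T _ (cons hi (cons hj (cons hk nil)))) <|
    Primrec.list_cons.comp (T _ (cons hk (cons hk nil))) (.const [])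

end Terms

theorem primrec_elemSquares : Primrec elemSquares := by
  refine Primrec.list_append.comp (Primrec.list_map Primrec.list_range
    (primrec_oneSq .fst .snd)) ?_
  refine Primrec.list_flatMap Primrec.list_range (Primrec.list_flatMap
    (Primrec.list_range.comp .fst) (Primrec.list_flatMap
      (Primrec.list_range.comp (Primrec.fst.comp .fst)) ?_))
  have hn : Primrec fun p : ((ℕ × ℕ) × ℕ) × ℕ => p.1.1.1 :=
    Primrec.fst.comp (Primrec.fst.comp .fst)
  have hi : Primrec fun p : ((ℕ × ℕ) × ℕ) × ℕ => p.1.1.2 :=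
    Primrec.snd.comp (Primrec.fst.comp .fst)
  have hj : Primrec fun p : ((ℕ × ℕ) × ℕ) × ℕ => p.1.2 := Primrec.snd.comp .fst
  exact Primrec.list_cons.comp (primrec_addSq hn hi hj .snd)
    (Primrec.list_cons.comp (primrec_mulSq hn hi hj .snd) (.const []))

theorem primrec_subsystemEqs : Primrec subsystemEqs :=
  Primrec.list_map (primrec_sublists'.comp primrec_elemSquares)
    (Primrec.pair .fst (Primrec.list_flatten.comp .snd))

theorem primrec₂_pinned : Primrec₂ pinned := by
  refine Primrec.pair (Primrec.fst.comp .fst) (Primrec.list_append.comp (Primrec.snd.comp .fst)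
    (Primrec.list_cons.comp (.const _) (Primrec.list_append.comp
      ((primrec_replicate _).comp .snd) ((primrec_replicate _).comp ?_))))
  exact Primrec.nat_mul.comp .snd .snd

/-- The equations of all subsystems of `E_n`, and the equations `E = 0 ∧ x₀ = n` for all `E` with
code at most `n`. -/
def candidates (n : ℕ) : List DiophEq :=
  subsystemEqs n ++
    (List.range (n + 1)).map fun e => pinned ((decode (α := DiophEq) e).getD (0, [])) n

theorem primrec_candidates : Primrec candidates := by
  refine Primrec.list_append.comp primrec_subsystemEqs
    (Primrec.list_map (Primrec.list_range.comp Primrec.succ) ?_)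
  exact primrec₂_pinned.comp
    (Primrec.option_getD.comp (Primrec.decode.comp .snd) (.const _)) .fst

theorem pinned_mem_candidates {E : DiophEq} {n : ℕ} (h : encode E ≤ n) :
    pinned E n ∈ candidates n :=
  List.mem_append_right _ (List.mem_map.2 ⟨encode E, by simpa [Nat.lt_succ_iff] using h, by
    rw [encodek]; rfl⟩)

/-! ### Computable sums and codings. -/

theorem computable_sum_range {α : Type*} [Primcodable α] {u : α → ℕ} {h : α → ℕ → ℕ}
    (hu : Computable u) (hh : Computable₂ h) :
    Computable fun a => ∑ i ∈ Finset.range (u a), h a i := by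
  have := Computable.nat_rec (f := u) (g := fun _ : α => 0) (h := fun a p => p.2 + h a p.1) hu
    (.const 0) (Primrec.nat_add.to_comp.comp (Computable.snd.comp .snd)
      (hh.comp .fst (Computable.fst.comp .snd)))
  refine this.of_eq fun a => ?_
  induction u a with
  | zero => rfl
  | succ n ih => rw [Finset.sum_range_succ, ← ih]

theorem computable_list_sum {α : Type*} [Primcodable α] {h : α → ℕ} (hh : Computable h) :
    Computable fun l : List α => (l.map h).sum := by
  have : Computable fun l : List α =>
      ∑ i ∈ Finset.range l.length, ((l[i]?).map h).getD 0 :=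
    computable_sum_range .list_length (Computable.option_getD
      (Computable.option_map Computable.list_getElem? (hh.comp .snd)) (.const 0))
  refine this.of_eq fun l => ?_
  induction l with
  | nil => rfl
  | cons a l ih =>
    rw [List.length_cons, Finset.sum_range_succ']
    simp only [List.getElem?_cons_succ, List.getElem?_cons_zero, Option.map_some, Option.getD_some]
    rw [ih, List.map_cons, List.sum_cons, add_comm]

/-- Lets the code of the algorithm's integer output serve as a natural upper bound. -/
theorem le_encode_int (z : ℤ) : z ≤ encode z := by
  cases z with
  | ofNat n => show (n : ℤ) ≤ ((2 * n : ℕ) : ℤ); omega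
  | negSucc n => exact (Int.negSucc_lt_zero n).le.trans (Int.natCast_nonneg _)

theorem computable_pnat {G : ℕ → ℕ} (hG : Computable G) :
    Computable fun k : ℕ+ => (G k.natPred).succPNat := by
  refine Computable.encode_iff.1 ?_
  -- A positive integer is coded by its predecessor.
  exact (hG.comp (Computable.encode (α := ℕ+))).of_eq fun k => rfl

/-! ### Passing from natural to integer unknowns by four squares. -/

/-- The `i`-th of `r` natural numbers written as sums of four squares of the integers
`z₁, …, z_{4r}`. -/
def sqSum {r : ℕ} (z : Fin (r * 4 + 1) → ℤ) (i : Fin r) : ℕ :=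
  ∑ j : Fin 4, (z (finProdFinEquiv (i, j)).succ).natAbs ^ 2

theorem exists_sqSum_eq {r : ℕ} (k : ℤ) (u : Fin r → ℕ) :
    ∃ z : Fin (r * 4 + 1) → ℤ, z 0 = k ∧ sqSum z = u := by
  have h : ∀ i, ∃ c : Fin 4 → ℕ, ∑ j, c j ^ 2 = u i := by
    intro i
    obtain ⟨a, b, c, d, h⟩ := Nat.sum_four_squares (u i)
    exact ⟨![a, b, c, d], by simpa [Fin.sum_univ_four] using h⟩
  choose c hc using h
  refine ⟨Fin.cons k fun v => (c (finProdFinEquiv.symm v).1 (finProdFinEquiv.symm v).2 : ℤ), rfl,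
    funext fun i => ?_⟩
  simp only [sqSum, Fin.cons_succ, Equiv.symm_apply_apply, Int.natAbs_natCast, hc]

/-- Each integer is bounded in absolute value by its square, hence by the sum it belongs to. -/
theorem finite_sqSum_mem {r : ℕ} (k : ℤ) {T : Set (Fin r → ℕ)} (hT : T.Finite) :
    {z : Fin (r * 4 + 1) → ℤ | z 0 = k ∧ sqSum z ∈ T}.Finite := by
  have : {z : Fin (r * 4 + 1) → ℤ | z 0 = k ∧ sqSum z ∈ T} ⊆
      ⋃ u ∈ T, Set.pi Set.univ (Fin.cons {k} fun v =>
        Set.Icc (-(u (finProdFinEquiv.symm v).1 : ℤ)) (u (finProdFinEquiv.symm v).1)) := by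
    rintro z ⟨hz, hzT⟩
    refine Set.mem_biUnion hzT fun v _ => ?_
    refine Fin.cases (by simpa using hz) (fun v => ?_) v
    obtain ⟨⟨i, j⟩, rfl⟩ := finProdFinEquiv.surjective v
    have h1 : (z (finProdFinEquiv (i, j)).succ).natAbs ^ 2 ≤ sqSum z i :=
      Finset.single_le_sum (f := fun j => (z (finProdFinEquiv (i, j)).succ).natAbs ^ 2)
        (fun _ _ => Nat.zero_le _) (Finset.mem_univ j)
    have h2 := (Nat.le_self_pow two_ne_zero _).trans h1
    simp only [Fin.cons_succ, Equiv.symm_apply_apply, Set.mem_Icc]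
    omega
  refine (hT.biUnion fun u _ => Set.Finite.pi fun v => ?_).subset this
  refine Fin.cases ?_ (fun v => ?_) v
  · simp
  · simp

theorem ncard_le_ncard_sqSum_mem {r : ℕ} (k : ℤ) {T : Set (Fin r → ℕ)} (hT : T.Finite) :
    T.ncard ≤ {z : Fin (r * 4 + 1) → ℤ | z 0 = k ∧ sqSum z ∈ T}.ncard := by
  have hsub : T ⊆ sqSum '' {z : Fin (r * 4 + 1) → ℤ | z 0 = k ∧ sqSum z ∈ T} := by
    intro u hu
    obtain ⟨z, hz, rfl⟩ := exists_sqSum_eq k u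
    exact ⟨z, ⟨hz, hu⟩, rfl⟩
  exact (Set.ncard_le_ncard hsub ((finite_sqSum_mem k hT).image _)).trans
    (Set.ncard_image_le (finite_sqSum_mem k hT))

/-! ### Many solutions from a finite-fold representation. -/

/-- A finite-fold representation of `g` yields, after splitting the value of the function into two
natural summands, an equation that has finitely many but more than `g k` solutions with first
coordinate `k`. -/
theorem exists_lt_ncard_solutions_pinned {g : ℕ+ → ℕ+} (hg : HasFiniteFoldRep (graph g)) :
    ∃ E : DiophEq, ∀ k : ℕ+, (pinned E k).solutions.Finite ∧
      (g k : ℕ) < (pinned E k).solutions.ncard := by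
  obtain ⟨m, W, hW, hfin⟩ := hg
  let N : Fin (m + 2) → MvPolynomial (Fin ((m + 2) * 4 + 1)) ℤ := fun i =>
    ∑ j : Fin 4, MvPolynomial.X (finProdFinEquiv (i, j)).succ ^ 2
  let D : MvPolynomial (Fin ((m + 2) * 4 + 1)) ℤ := MvPolynomial.aeval
    (Sum.elim ![MvPolynomial.X 0, N 0 + N 1] fun i => N i.succ.succ) W
  -- `D` is squared so that adding `(x₀ - k)²` forces both summands to vanish.
  obtain ⟨L, hL⟩ := DiophEq.exists_poly_eq _ (D ^ 2)
  refine ⟨((m + 2) * 4 + 1, L), fun k => ?_⟩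
  let T : Set (Fin (m + 2) → ℕ) := {u | MvPolynomial.eval
    (fun v => ((Sum.elim ![(k : ℕ), u 0 + u 1] (fun i => u i.succ.succ) v : ℕ) : ℤ)) W = 0}
  have hN : ∀ z i, MvPolynomial.eval z (N i) = (sqSum z i : ℤ) := by
    intro z i
    simp [N, sqSum]
  have hD : ∀ z, z 0 = ((k : ℕ) : ℤ) → MvPolynomial.eval z D = MvPolynomial.eval
      (fun v => ((Sum.elim ![(k : ℕ), sqSum z 0 + sqSum z 1]
        (fun i => sqSum z i.succ.succ) v : ℕ) : ℤ)) W := by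
    intro z hz
    rw [MvPolynomial.map_aeval]
    refine congrArg₂ (fun φ v => MvPolynomial.eval₂Hom φ v W) (Subsingleton.elim _ _) ?_
    funext v
    rcases v with v | v
    · fin_cases v
      · simpa using hz
      · simp [hN]
    · simp [hN]
  have hsol : (pinned ((m + 2) * 4 + 1, L) k).solutions =
      {z | z 0 = ((k : ℕ) : ℤ) ∧ sqSum z ∈ T} := by
    refine Set.ext fun (z : Fin ((m + 2) * 4 + 1) → ℤ) => mem_solutions_pinned.trans ?_
    rw [← eval_poly, hL, map_pow, add_eq_zero_iff_of_nonneg (sq_nonneg _) (sq_nonneg _),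
      sq_eq_zero_iff, sq_eq_zero_iff, sub_eq_zero, and_comm]
    refine and_congr_right fun hz => ?_
    rw [hD z hz]
    rfl
  have hT : T.Finite := by
    refine (((Set.finite_Iic (g k : ℕ)).prod ((Set.finite_Iic (g k : ℕ)).prod
      (hfin ![k, g k]))).image
        fun p => (Fin.cons p.1 (Fin.cons p.2.1 p.2.2) : Fin (m + 2) → ℕ)).subset ?_
    intro u hu
    -- A solution certifies that `(k, u 0 + u 1)` lies on the graph, which bounds both summands by
    -- `g k`.
    obtain ⟨k', h0, h1⟩ := (hW _).2 ⟨_, hu⟩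
    obtain rfl : k = k' := PNat.coe_injective h0
    have h1 : u 0 + u 1 = g k := h1
    refine ⟨(u 0, u 1, fun i => u i.succ.succ), ⟨?_, ?_, ?_⟩, ?_⟩
    · simp; omega
    · simp; omega
    · rw [← h1]; exact hu
    · refine funext fun i => Fin.cases rfl (fun i => Fin.cases rfl (fun i => rfl) i) i
  rw [hsol]
  refine ⟨finite_sqSum_mem _ hT, lt_of_lt_of_le ?_ (ncard_le_ncard_sqSum_mem _ hT)⟩
  obtain ⟨x, hx⟩ := (hW ![k, g k]).1 ⟨k, rfl, rfl⟩
  -- One witness `x` combines with all `g k + 1` splittings of `g k`.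
  have hsub : (fun t : ℕ => (Fin.cons t (Fin.cons (g k - t) x) : Fin (m + 2) → ℕ)) ''
      (Finset.range (g k + 1) : Set ℕ) ⊆ T := by
    rintro _ ⟨t, ht, rfl⟩
    have : t + (g k - t) = (g k : ℕ) := by simp at ht; omega
    show MvPolynomial.eval (fun v => ((Sum.elim ![(k : ℕ), t + (g k - t)] x v : ℕ) : ℤ)) W = 0
    rw [this]
    exact hx
  have hinj : Function.Injective
      fun t : ℕ => (Fin.cons t (Fin.cons (g k - t) x) : Fin (m + 2) → ℕ) :=
    fun s t h => congrFun h 0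
  have := Set.ncard_le_ncard hsub hT
  rw [Set.ncard_image_of_injective _ hinj, Set.ncard_coe_finset, Finset.card_range] at this
  omega

/-! ### Enumerability of the graph, and the diagonal argument. -/

theorem rePred_graph {G : ℕ → ℕ} (hG : Computable G) :
    REPred fun a => a ∈ graph fun k => (G k.natPred).succPNat := by
  have h0 : ∀ i : Fin 2, Computable fun a : Fin 2 → ℕ => a i :=
    fun i => Computable.fin_app.comp .id (.const i)
  have hp : PrimrecPred fun p : ℕ × ℕ × ℕ => p.1 ≠ 0 ∧ p.2.1 = p.2.2 + 1 :=
    (Primrec.eq.comp .fst (.const 0)).not.and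
      (Primrec.eq.comp (Primrec.fst.comp .snd) (Primrec.succ.comp (Primrec.snd.comp .snd)))
  have hq : Computable fun a : Fin 2 → ℕ => (a 0, a 1, G (a 0 - 1)) :=
    (h0 0).pair ((h0 1).pair (hG.comp (Computable.pred.comp (h0 0))))
  have h : ComputablePred fun a : Fin 2 → ℕ => a 0 ≠ 0 ∧ a 1 = G (a 0 - 1) + 1 :=
    ⟨inferInstance, (hp.decide.to_comp.comp hq).of_eq fun a => rfl⟩
  refine h.to_re.of_eq fun a => ?_
  constructor
  · rintro ⟨ha, hb⟩
    exact ⟨⟨a 0, Nat.pos_of_ne_zero ha⟩, rfl, hb⟩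
  · rintro ⟨k, ha, hb⟩
    rw [ha, hb]
    exact ⟨k.ne_zero, rfl⟩

end FiniteFold

theorem theorem2 (hQ : FiniteFold.CountBoundComputable) :
    (∃ g : ℕ+ → ℕ+, Computable g ∧ StrictMono g ∧
      (∀ n : ℕ+, FiniteFold.f n ≤ (g n : ℕ)) ∧
      ¬ FiniteFold.HasFiniteFoldRep (FiniteFold.graph g)) ∧
    ¬ FiniteFold.MatiyasevichConjecture := by
  open FiniteFold Encodable in
  obtain ⟨A, hA, hAlt⟩ := hQ
  let H : ℕ → ℕ := fun n => ((candidates n).map fun E => encode (A E)).sum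
  have hH : Computable H := (computable_list_sum (Computable.encode.comp hA)).comp
    primrec_candidates.to_comp
  have hlt : ∀ {n : ℕ} {E : DiophEq}, E ∈ candidates n → E.solutions.Finite →
      E.solutions.ncard < H n := by
    intro n E hE hfin
    have h1 := (hAlt E hfin).trans_le (le_encode_int _)
    exact (Nat.cast_lt.1 h1).trans_le (List.single_le_sum (fun _ _ => Nat.zero_le _) _
      (List.mem_map_of_mem hE))
  -- The summand `n` makes `G` strictly increasing. Since `G` is used at `n = k - 1`, the range must
  -- reach index `n + 1 = k`.
  let G : ℕ → ℕ := fun n => n + ∑ i ∈ Finset.range (n + 2), H i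
  have hG : Computable G := Primrec.nat_add.to_comp.comp .id
    (computable_sum_range (Primrec.succ.comp Primrec.succ).to_comp (hH.comp .snd))
  have hGmono : StrictMono G := by
    refine strictMono_nat_of_lt_succ fun n => ?_
    simp only [G, Finset.sum_range_succ _ (n + 2)]
    omega
  let g : ℕ+ → ℕ+ := fun k => (G k.natPred).succPNat
  have hHg : ∀ k : ℕ+, H k ≤ g k := by
    intro k
    have h2 : (k : ℕ) = k.natPred + 1 := k.natPred_add_one.symm
    have h1 : H k ≤ ∑ i ∈ Finset.range (k.natPred + 2), H i :=
      Finset.single_le_sum (fun _ _ => Nat.zero_le _) (Finset.mem_range.2 (by omega))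
    show H k ≤ G k.natPred + 1
    simp only [G]
    omega
  have hrep : ¬ HasFiniteFoldRep (graph g) := by
    intro h
    obtain ⟨E, hE⟩ := exists_lt_ncard_solutions_pinned h
    -- The successor of the code is positive and at least the code, so the pinned equation is among
    -- the candidates.
    obtain ⟨hfin, hcard⟩ := hE (encode E).succPNat
    have h1 := hlt (pinned_mem_candidates (n := (encode E).succPNat) (Nat.le_succ _)) hfin
    have h2 := hHg (encode E).succPNat
    omega
  refine ⟨⟨g, computable_pnat hG, ?_, fun n => ?_, hrep⟩, fun hM =>
    hrep (hM 2 _ (rePred_graph hG))⟩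
  · intro a b hab
    exact Nat.succPNat_lt_succPNat.2 (hGmono (PNat.natPred_lt_natPred.2 hab))
  · obtain ⟨S, hS, hcard⟩ := (f_isGreatest n).1
    obtain ⟨L, hL, hsol⟩ := exists_subsystemEqs S
    rw [← hcard, ← hsol]
    exact (hlt (List.mem_append_left _ hL) (hsol ▸ hS)).le.trans (hHg n)
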